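/- For $u\in\mathcal S(\mathbb R\times\mathbb R)$ (complex-valued Schwartz functions of $(t,x)$) put $\widetilde u(\tau,\xi)=\int e^{-it\tau-ix\xi}u(t,x)\,dt\,dx$, $\langle y\rangle=\sqrt{1+y^2}$, and for $s,b\in\mathbb R$ $$\|u\|_{X^{s,b}_{\tau=\xi^5}}=\big\|\langle\xi\rangle^{s}\langle\tau-\xi^5\rangle^{b}\,\widetilde u(\tau,\xi)\big\|_{L^2_{\tau,\xi}(\mathbb R\times\mathbb R)} .$$ (i) There is $\epsilon_0>0$ such that for every $0<\epsilon<\epsilon_0$ there is a constant $C=C(\epsilon)<\infty$ such that for all Schwartz functions $u,v$ on $\mathbb R\times\mathbb R$ $$\|uv\|_{L^2(\mathbb R\times\mathbb R)}\le C\|u\|_{X^{-3/2,1/2-\epsilon}_{\tau=\xi^5}}\|v\|_{X^{3/4,1/2+\epsilon}_{\tau=\xi^5}},$$ $$\|uv\|_{L^2(\mathbb R\times\mathbb R)}\le C\|u\|_{X^{-3/4,1/2-\epsilon}_{\tau=\xi^5}}\|v\|_{X^{0,1/2+\epsilon}_{\tau=\xi^5}},$$ $$\|uv\|_{L^2(\mathbb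 R\times\mathbb R)}\le C\|u\|_{X^{-1/4,1/2-\epsilon}_{\tau=\xi^5}}\|v\|_{X^{-1/2,1/2+\epsilon}_{\tau=\xi^5}}.$$ (ii) More generally, let $\alpha,\beta\in\mathbb R$ satisfy $\alpha<2$, $\beta>-2$ and $\alpha-\beta\le 3/4$ (the condition $\beta>-2$ is automatic from the last one when $\alpha>-5/4$, in particular when $\alpha\ge 0$). Then there is $\epsilon_0=\epsilon_0(\alpha,\beta)>0$ such that for every $0<\epsilon<\epsilon_0$ there is a constant $C=C(\alpha,\beta,\epsilon)<\infty$ such that for all Schwartz functions $u,v$ on $\mathbb R\times\mathbb R$ $$\|uv\|_{L^2(\mathbb R\times\mathbb R)}\le C\|u\|_{X^{-\alpha,1/2-\epsilon}_{\tau=\xi^5}}\|v\|_{X^{\beta,1/2+\epsilon}_{\tau=\xi^5}}.$$ -/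

import Mathlib

open MeasureTheory
open scoped SchwartzMap NNReal ENNReal

noncomputable section

/-- Japanese bracket `⟨x⟩ = √(1 + x²)`. -/
def japaneseBracket (x : ℝ) : ℝ := Real.sqrt (1 + x ^ 2)

/-- Space-time Fourier transform `ũ(τ, ξ) = ∫ e^{-itτ - ixξ} u(t, x) dt dx` (no factor `2π`);
points of the physical side are `(t, x)`, points of the frequency side are `(τ, ξ)`. -/
def spaceTimeFourier (u : ℝ × ℝ → ℂ) (q : ℝ × ℝ) : ℂ :=
  ∫ p : ℝ × ℝ,
    Complex.exp (-(Complex.I * (p.1 : ℂ) * (q.1 : ℂ)) - Complex.I * (p.2 : ℂ) * (q.2 : ℂ)) * u p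

/-- The Bourgain norm
`‖u‖_{X^{s,b}_{τ=ξ⁵}} = ‖⟨ξ⟩^s ⟨τ - ξ⁵⟩^b ũ(τ, ξ)‖_{L²_{τ,ξ}}`,
as an extended nonnegative real. -/
def bourgainNorm (s b : ℝ) (u : ℝ × ℝ → ℂ) : ℝ≥0∞ :=
  eLpNorm
    (fun q : ℝ × ℝ =>
      ((japaneseBracket q.2 ^ s * japaneseBracket (q.1 - q.2 ^ 5) ^ b : ℝ) : ℂ)
        * spaceTimeFourier u q)
    2 volume

/-- The estimate `‖uv‖_{L²} ≤ C ‖u‖_{X^{s₁,1/2-ε}} ‖v‖_{X^{s₂,1/2+ε}}` with a finite constant `C`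
that is independent of the Schwartz functions `u`, `v`. -/
def BilinearL2Estimate (ε s₁ s₂ : ℝ) : Prop :=
  ∃ C : ℝ≥0, ∀ u v : 𝓢(ℝ × ℝ, ℂ),
    eLpNorm (fun p : ℝ × ℝ => u p * v p) 2 volume
      ≤ C * bourgainNorm s₁ (1 / 2 - ε) u * bourgainNorm s₂ (1 / 2 + ε) v

end

/-!
By monotonicity in the exponents only the endpoint `β = α - 3 / 4`, `-5 / 4 < α < 2`, matters.
Plancherel's theorem (`exists_sq_eLpNorm_mul_le`) turns the estimate into the boundedness on `L²` of
the bilinear convolution operator whose multiplier `K` is `bilinearKernel`. Write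
`σⱼ = τⱼ - ξⱼ ^ 5` and `m² = ⟨ξ₁⟩ ^ (2α) ⟨ξ₂⟩ ^ (3/2 - 2α)`, so that
`K² = m² ⟨σ₁⟩ ^ (-1 + 2ε) ⟨σ₂⟩ ^ (-1 - 2ε)`. There are two ways to apply Cauchy–Schwarz
(`lintegral_sq_kernel_le`): it suffices that `∫ K²` over the second frequency is bounded uniformly
in the first one, or that `∫ K²` over the pairs of frequencies with a given sum is bounded uniformly
in the sum. The frequency space is cut along the level `|ξ₁ ^ 4 - ξ₂ ^ 4| = ⟨σ₁⟩ ^ (4ε) m²`.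

* Above this level, `K² ≤ |ξ₁ ^ 4 - ξ₂ ^ 4| ⟨σ₁⟩ ^ (-1 - 2ε) ⟨σ₂⟩ ^ (-1 - 2ε)`. For a fixed sum `ξ`
  of the frequencies, `5 (ξ₁ ^ 4 - ξ₂ ^ 4)` is the derivative of the phase
  `ξ₁ ^ 5 + (ξ - ξ₁) ^ 5`, so a change of variables bounds the integral by that of two integrable
  functions of the modulations (`lintegral_resonance_le`,
  `exists_lintegral_nonResonant_kernel_le`).
* Below this level, put `μ = ⟨σ₁⟩ ^ (4ε)`. Either both frequencies are at most a power of `μ`, or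
  they are comparable and `||ξ₁| - |ξ₂|| ≲ μ ⟨ξ₁⟩ ^ (-3/2)`, a length that compensates exactly the weight
  `m² ∼ ⟨ξ₁⟩ ^ (3/2)`. So `∫ m² dξ₂` is at most a power of `μ`
  (`exists_lintegral_nearResonant_le`), which the factor `⟨σ₁⟩ ^ (-1 + 2ε)` absorbs for small `ε`
  (`exists_lintegral_nearResonant_kernel_le`).
-/

open scoped FourierTransform

noncomputable section

/-! ### The Japanese bracket -/

theorem one_le_japaneseBracket (x : ℝ) : 1 ≤ japaneseBracket x := by
  rw [japaneseBracket, Real.one_le_sqrt]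
  nlinarith [sq_nonneg x]

theorem japaneseBracket_pos (x : ℝ) : 0 < japaneseBracket x :=
  one_pos.trans_le (one_le_japaneseBracket x)

theorem sq_japaneseBracket (x : ℝ) : japaneseBracket x ^ 2 = 1 + x ^ 2 :=
  Real.sq_sqrt (by positivity)

theorem abs_le_japaneseBracket (x : ℝ) : |x| ≤ japaneseBracket x :=
  Real.abs_le_sqrt (by nlinarith)

theorem measurable_japaneseBracket : Measurable japaneseBracket := by
  unfold japaneseBracket
  fun_prop

attribute [fun_prop] measurable_japaneseBracket

theorem lintegral_japaneseBracket_rpow_lt_top {r : ℝ} (hr : 1 < r) :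
    ∫⁻ x : ℝ, ENNReal.ofReal (japaneseBracket x ^ (-r)) < ⊤ := by
  have h := integrable_rpow_neg_one_add_norm_sq (E := ℝ) (μ := volume) (r := r) (by simpa using hr)
  have h2 := h.lintegral_lt_top
  refine lt_of_eq_of_lt (lintegral_congr fun x => ?_) h2
  rw [japaneseBracket, Real.sqrt_eq_rpow, ← Real.rpow_mul (by positivity), Real.norm_eq_abs, sq_abs]
  congr 2
  ring

/-! ### The resonance function -/

/-- The phase `x ↦ x ^ 5 + (ξ - x) ^ 5` has two monotone branches, separated by `x = ξ / 2`; each of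
them pushes `|x ^ 4 - (ξ - x) ^ 4| dx`, up to the factor `5`, to at most Lebesgue measure. -/
theorem lintegral_resonance_le (ξ τ : ℝ) (J : ℝ → ℝ≥0∞) :
    ∫⁻ x : ℝ, ENNReal.ofReal |x ^ 4 - (ξ - x) ^ 4| * J (τ - x ^ 5 - (ξ - x) ^ 5)
      ≤ 2 * ∫⁻ s : ℝ, J s := by
  set φ : ℝ → ℝ := fun x => τ - x ^ 5 - (ξ - x) ^ 5 with hφ
  have hd : ∀ x, HasDerivAt φ (-(5 * (x ^ 4 - (ξ - x) ^ 4))) x := by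
    intro x
    have h1 := (((hasDerivAt_id x).pow 5).const_sub τ).sub (((hasDerivAt_id x).const_sub ξ).pow 5)
    convert! h1 using 1
    simp
    ring
  have hc : Continuous φ := by fun_prop
  have hdiff : Differentiable ℝ φ := fun x => (hd x).differentiableAt
  have hfac : ∀ x, x ^ 4 - (ξ - x) ^ 4 = ξ * (2 * x - ξ) * (x ^ 2 + (ξ - x) ^ 2) := by
    intro x; ring
  have key : ∀ s : Set ℝ, MeasurableSet s → Convex ℝ s →
      ((∀ x ∈ s, 0 ≤ x ^ 4 - (ξ - x) ^ 4) ∨ (∀ x ∈ s, x ^ 4 - (ξ - x) ^ 4 ≤ 0)) →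
      ∫⁻ x in s, ENNReal.ofReal |x ^ 4 - (ξ - x) ^ 4| * J (φ x) ≤ ∫⁻ t : ℝ, J t := by
    rintro s hs hconv (h | h)
    · have hm : AntitoneOn φ s := by
        refine antitoneOn_of_deriv_nonpos hconv hc.continuousOn hdiff.differentiableOn ?_
        intro x hx
        rw [(hd x).deriv]
        have := h x (interior_subset hx)
        linarith
      have e := lintegral_image_eq_lintegral_deriv_mul_of_antitoneOn hs
        (fun x _ => (hd x).hasDerivWithinAt) hm J
      calc _ ≤ ∫⁻ x in s, ENNReal.ofReal (-(-(5 * (x ^ 4 - (ξ - x) ^ 4)))) * J (φ x) := by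
            refine setLIntegral_mono' hs fun x hx => ?_
            gcongr
            rw [abs_of_nonneg (h x hx)]
            linarith [h x hx]
        _ = ∫⁻ x in φ '' s, J x := e.symm
        _ ≤ _ := setLIntegral_le_lintegral _ _
    · have hm : MonotoneOn φ s := by
        refine monotoneOn_of_deriv_nonneg hconv hc.continuousOn hdiff.differentiableOn ?_
        intro x hx
        rw [(hd x).deriv]
        have := h x (interior_subset hx)
        linarith
      have e := lintegral_image_eq_lintegral_deriv_mul_of_monotoneOn hs
        (fun x _ => (hd x).hasDerivWithinAt) hm J
      calc _ ≤ ∫⁻ x in s, ENNReal.ofReal (-(5 * (x ^ 4 - (ξ - x) ^ 4))) * J (φ x) := by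
            refine setLIntegral_mono' hs fun x hx => ?_
            gcongr
            rw [abs_of_nonpos (h x hx)]
            linarith [h x hx]
        _ = ∫⁻ x in φ '' s, J x := e.symm
        _ ≤ _ := setLIntegral_le_lintegral _ _
  have hpos : ∀ x, 0 ≤ x ^ 2 + (ξ - x) ^ 2 := fun x => by positivity
  rw [← lintegral_add_compl _ (measurableSet_Iic (a := ξ / 2)), Set.compl_Iic, two_mul]
  refine add_le_add (key _ measurableSet_Iic (convex_Iic _) ?_)
    (key _ measurableSet_Ioi (convex_Ioi _) ?_)
  · rcases le_total 0 ξ with h0 | h0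
    · right
      intro x hx
      rw [Set.mem_Iic] at hx
      rw [hfac]
      exact mul_nonpos_of_nonpos_of_nonneg
        (mul_nonpos_of_nonneg_of_nonpos h0 (by linarith)) (hpos x)
    · left
      intro x hx
      rw [Set.mem_Iic] at hx
      rw [hfac]
      exact mul_nonneg (mul_nonneg_of_nonpos_of_nonpos h0 (by linarith)) (hpos x)
  · rcases le_total 0 ξ with h0 | h0
    · left
      intro x hx
      rw [Set.mem_Ioi] at hx
      rw [hfac]
      exact mul_nonneg (mul_nonneg h0 (by linarith)) (hpos x)
    · right
      intro x hx
      rw [Set.mem_Ioi] at hx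
      rw [hfac]
      exact mul_nonpos_of_nonpos_of_nonneg
        (mul_nonpos_of_nonpos_of_nonneg h0 (by linarith)) (hpos x)

/-! ### Bilinear convolution operators on `L²` -/

/-- Cauchy–Schwarz for the Lebesgue integral of nonnegative functions. -/
theorem sq_lintegral_mul_le {X : Type*} [MeasurableSpace X] (μ : Measure X) {a b : X → ℝ≥0∞}
    (ha : AEMeasurable a μ) (hb : AEMeasurable b μ) :
    (∫⁻ x, a x * b x ∂μ) ^ 2 ≤ (∫⁻ x, a x ^ 2 ∂μ) * ∫⁻ x, b x ^ 2 ∂μ := by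
  have h := ENNReal.lintegral_mul_le_Lp_mul_Lq μ Real.HolderConjugate.two_two ha hb
  simp only [Pi.mul_apply, ENNReal.rpow_two] at h
  calc _ ≤ _ := pow_le_pow_left' h 2
    _ = _ := by
      rw [mul_pow, ← ENNReal.rpow_two, ← ENNReal.rpow_two, ← ENNReal.rpow_mul, ← ENNReal.rpow_mul]
      norm_num

section Kernel

variable {V : Type*} [AddCommGroup V] [MeasurableSpace V] [MeasurableAdd₂ V] [MeasurableNeg V]
  [MeasurableSub₂ V] {μ : Measure V} [SFinite μ] [μ.IsAddLeftInvariant]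

/-- A kernel that is square integrable in its second argument, uniformly in the first, defines a
bounded bilinear map on `L²`. -/
theorem lintegral_sq_kernel_le_of_forall_left {K : V × V → ℝ≥0∞} (hK : Measurable K) {C : ℝ≥0∞}
    (hC : ∀ p, ∫⁻ q', K (p, q') ^ 2 ∂μ ≤ C) {f g : V → ℝ≥0∞} (hf : Measurable f)
    (hg : Measurable g) :
    ∫⁻ q, (∫⁻ q', K (q - q', q') * (f (q - q') * g q') ∂μ) ^ 2 ∂μ
      ≤ C * ((∫⁻ p, f p ^ 2 ∂μ) * ∫⁻ p, g p ^ 2 ∂μ) := by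
  have h1 : ∀ q, (∫⁻ q', K (q - q', q') * (f (q - q') * g q') ∂μ) ^ 2
      ≤ (∫⁻ q', K (q - q', q') ^ 2 * f (q - q') ^ 2 ∂μ) * ∫⁻ p, g p ^ 2 ∂μ := by
    intro q
    simp_rw [← mul_assoc, ← mul_pow]
    exact sq_lintegral_mul_le μ (by fun_prop) (by fun_prop)
  calc _ ≤ ∫⁻ q, (∫⁻ q', K (q - q', q') ^ 2 * f (q - q') ^ 2 ∂μ) * ∫⁻ p, g p ^ 2 ∂μ ∂μ :=
        lintegral_mono h1
    _ = (∫⁻ q', ∫⁻ q, K (q - q', q') ^ 2 * f (q - q') ^ 2 ∂μ ∂μ) * ∫⁻ p, g p ^ 2 ∂μ := by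
        rw [lintegral_mul_const _ (by fun_prop), lintegral_lintegral_swap (by fun_prop)]
    _ = (∫⁻ q', ∫⁻ p, K (p, q') ^ 2 * f p ^ 2 ∂μ ∂μ) * ∫⁻ p, g p ^ 2 ∂μ := by
        congr 2 with q'
        exact lintegral_sub_right_eq_self (fun p => K (p, q') ^ 2 * f p ^ 2) q'
    _ = (∫⁻ p, (∫⁻ q', K (p, q') ^ 2 ∂μ) * f p ^ 2 ∂μ) * ∫⁻ p, g p ^ 2 ∂μ := by
        rw [lintegral_lintegral_swap (by fun_prop)]
        congr 2 with p
        rw [lintegral_mul_const _ (by fun_prop)]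
    _ ≤ (∫⁻ p, C * f p ^ 2 ∂μ) * ∫⁻ p, g p ^ 2 ∂μ := by
        gcongr with p
        exact hC p
    _ = _ := by rw [lintegral_const_mul _ (by fun_prop), mul_assoc]

/-- A kernel that is square integrable along each line `p + q' = q`, uniformly in `q`, defines a
bounded bilinear map on `L²`. -/
theorem lintegral_sq_kernel_le_of_forall_sum {K : V × V → ℝ≥0∞} (hK : Measurable K) {C : ℝ≥0∞}
    (hC : ∀ q, ∫⁻ q', K (q - q', q') ^ 2 ∂μ ≤ C) {f g : V → ℝ≥0∞} (hf : Measurable f)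
    (hg : Measurable g) :
    ∫⁻ q, (∫⁻ q', K (q - q', q') * (f (q - q') * g q') ∂μ) ^ 2 ∂μ
      ≤ C * ((∫⁻ p, f p ^ 2 ∂μ) * ∫⁻ p, g p ^ 2 ∂μ) := by
  calc _ ≤ ∫⁻ q, C * ∫⁻ q', f (q - q') ^ 2 * g q' ^ 2 ∂μ ∂μ := by
        refine lintegral_mono fun q => ?_
        refine (sq_lintegral_mul_le μ (by fun_prop) (by fun_prop)).trans ?_
        simp_rw [mul_pow]
        gcongr
        exact hC q
    _ = C * ∫⁻ q', ∫⁻ q, f (q - q') ^ 2 * g q' ^ 2 ∂μ ∂μ := by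
        rw [lintegral_const_mul _ (by fun_prop), lintegral_lintegral_swap (by fun_prop)]
    _ = C * ∫⁻ q', (∫⁻ p, f p ^ 2 ∂μ) * g q' ^ 2 ∂μ := by
        congr 2 with q'
        rw [lintegral_mul_const _ (by fun_prop)]
        congr 1
        exact lintegral_sub_right_eq_self (fun p => f p ^ 2) q'
    _ = _ := by rw [lintegral_const_mul _ (by fun_prop)]

/-- If a set `S` splits the kernel into a part that is uniformly square integrable in the second
argument and a part that is uniformly square integrable along the lines `p + q' = q`, then the
kernel defines a bounded bilinear map on `L²`. -/
theorem lintegral_sq_kernel_le {K : V × V → ℝ≥0∞} (hK : Measurable K) {S : Set (V × V)}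
    (hS : MeasurableSet S) {A B : ℝ≥0∞}
    (hA : ∀ p, ∫⁻ q', S.indicator K (p, q') ^ 2 ∂μ ≤ A)
    (hB : ∀ q, ∫⁻ q', Sᶜ.indicator K (q - q', q') ^ 2 ∂μ ≤ B)
    {f g : V → ℝ≥0∞} (hf : Measurable f) (hg : Measurable g) :
    ∫⁻ q, (∫⁻ q', K (q - q', q') * (f (q - q') * g q') ∂μ) ^ 2 ∂μ
      ≤ 2 * (A + B) * ((∫⁻ p, f p ^ 2 ∂μ) * ∫⁻ p, g p ^ 2 ∂μ) := by
  have hKS := hK.indicator hS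
  have hKS' := hK.indicator hS.compl
  have h1 := lintegral_sq_kernel_le_of_forall_left hKS hA hf hg
  have h2 := lintegral_sq_kernel_le_of_forall_sum hKS' hB hf hg
  have hsq : ∀ a b : ℝ≥0∞, (a + b) ^ 2 ≤ 2 * (a ^ 2 + b ^ 2) := by
    intro a b
    have := ENNReal.rpow_add_le_mul_rpow_add_rpow a b (p := 2) (by norm_num)
    norm_num at this
    simpa using this
  have hsplit : ∀ q, (∫⁻ q', K (q - q', q') * (f (q - q') * g q') ∂μ) ^ 2
      ≤ 2 * ((∫⁻ q', S.indicator K (q - q', q') * (f (q - q') * g q') ∂μ) ^ 2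
        + (∫⁻ q', Sᶜ.indicator K (q - q', q') * (f (q - q') * g q') ∂μ) ^ 2) := by
    intro q
    refine le_trans (le_of_eq ?_) (hsq _ _)
    rw [← lintegral_add_left (by fun_prop)]
    congr 2 with q'
    rw [← add_mul, Set.indicator_self_add_compl_apply]
  calc _ ≤ _ := lintegral_mono hsplit
    _ = 2 * (∫⁻ q, (∫⁻ q', S.indicator K (q - q', q') * (f (q - q') * g q') ∂μ) ^ 2 ∂μ
        + ∫⁻ q, (∫⁻ q', Sᶜ.indicator K (q - q', q') * (f (q - q') * g q') ∂μ) ^ 2 ∂μ) := by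
        rw [lintegral_const_mul _ (by fun_prop), lintegral_add_left (by fun_prop)]
    _ ≤ _ := by
        rw [mul_assoc, add_mul]
        gcongr

end Kernel

/-! ### Frequencies near resonance -/

/-- If the larger bracket `M` dominates the resonance factor, then near resonance it is bounded by a
power of `μ`: the weight `Z ^ a * M ^ b` is at most `M ^ (4 - p)`, which leaves `M ^ p ≤ 2μ`. -/
theorem le_rpow_inv_of_pow_four_le {a b p μ Z M : ℝ} (hab : a + b = 3 / 2) (hp : 0 < p)
    (hpb : p ≤ 4 - b) (hp' : p ≤ 5 / 2) (hZ : 1 ≤ Z) (hZM : Z ≤ M)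
    (h : M ^ 4 ≤ 2 * μ * (Z ^ a * M ^ b)) (hμ : 1 ≤ μ) :
    M ≤ (2 * μ) ^ p⁻¹ ∧ Z ^ a * M ^ b ≤ ((2 * μ) ^ p⁻¹) ^ 4 := by
  have hM : 1 ≤ M := hZ.trans hZM
  have hM0 : 0 < M := by linarith
  have hZ0 : 0 < Z := by linarith
  have hm : Z ^ a * M ^ b ≤ M ^ (4 - p) := by
    rcases le_total a 0 with ha | ha
    · calc Z ^ a * M ^ b ≤ 1 * M ^ (4 - p) := by
            gcongr
            · exact Real.rpow_le_one_of_one_le_of_nonpos hZ ha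
            · linarith
        _ = _ := one_mul _
    · calc Z ^ a * M ^ b ≤ M ^ a * M ^ b := by gcongr
        _ = M ^ (3 / 2 : ℝ) := by rw [← Real.rpow_add hM0, hab]
        _ ≤ _ := Real.rpow_le_rpow_of_exponent_le hM (by linarith)
  have h4 : M ^ 4 = M ^ (4 - p) * M ^ p := by
    rw [← Real.rpow_add hM0, ← Real.rpow_natCast]
    congr 1
    norm_num
  have hpos : 0 < M ^ (4 - p) := Real.rpow_pos_of_pos hM0 _
  have hMp : M ^ p ≤ 2 * μ := by
    have : M ^ (4 - p) * M ^ p ≤ M ^ (4 - p) * (2 * μ) := by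
      rw [← h4]
      nlinarith
    exact le_of_mul_le_mul_left this hpos
  have hMR : M ≤ (2 * μ) ^ p⁻¹ := by
    rw [← Real.rpow_rpow_inv hM0.le hp.ne']
    gcongr
  refine ⟨hMR, hm.trans ?_⟩
  calc M ^ (4 - p) ≤ M ^ (4 : ℝ) := Real.rpow_le_rpow_of_exponent_le hM (by linarith)
    _ = M ^ 4 := by rw [← Real.rpow_natCast]; norm_num
    _ ≤ _ := by gcongr

theorem rpow_mul_rpow_le_of_comparable {a b X Y : ℝ} (hab : a + b = 3 / 2) (ha : a < 4)
    (hb : b < 4) (hX : 0 < X) (h1 : X ≤ 2 * Y) (h2 : Y ≤ 2 * X) :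
    X ^ a * Y ^ b ≤ 16 * X ^ (3 / 2 : ℝ) := by
  have hY : 0 < Y := by linarith
  have h16 : (Y / X) ^ b ≤ 16 := by
    rcases le_total 0 b with h0 | h0
    · calc (Y / X) ^ b ≤ 2 ^ b := by
            gcongr
            rwa [div_le_iff₀ hX]
        _ ≤ 2 ^ (4 : ℝ) := Real.rpow_le_rpow_of_exponent_le (by norm_num) hb.le
        _ = 16 := by norm_num
    · calc (Y / X) ^ b = (X / Y) ^ (-b) := by
            rw [Real.rpow_neg (by positivity), ← Real.inv_rpow (by positivity), inv_div]
        _ ≤ 2 ^ (-b) := by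
            have : 0 ≤ -b := by linarith
            gcongr
            rwa [div_le_iff₀ hY]
        _ ≤ 2 ^ (4 : ℝ) := Real.rpow_le_rpow_of_exponent_le (by norm_num) (by linarith)
        _ = 16 := by norm_num
  calc X ^ a * Y ^ b = (Y / X) ^ b * X ^ (3 / 2 : ℝ) := by
        rw [← hab, Real.rpow_add hX, Real.div_rpow hY.le hX.le]
        field_simp
    _ ≤ _ := by gcongr

theorem volume_abs_sub_abs_le (x r : ℝ) :
    volume {y : ℝ | |(|x| - |y|)| ≤ r} ≤ ENNReal.ofReal (4 * r) := by
  have hsub : {y : ℝ | |(|x| - |y|)| ≤ r} ⊆ Metric.closedBall x r ∪ Metric.closedBall (-x) r := by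
    intro y hy
    simp only [Set.mem_ofPred_eq, Set.mem_union, Metric.mem_closedBall, Real.dist_eq] at hy ⊢
    rcases abs_cases x with ⟨h1, _⟩ | ⟨h1, _⟩ <;> rcases abs_cases y with ⟨h2, _⟩ | ⟨h2, _⟩ <;>
      rw [h1, h2] at hy <;> rw [abs_le] at hy
    · left; rw [abs_le]; constructor <;> linarith
    · right; rw [abs_le]; constructor <;> linarith
    · right; rw [abs_le]; constructor <;> linarith
    · left; rw [abs_le]; constructor <;> linarith
  refine (measure_mono hsub).trans ((measure_union_le _ _).trans ?_)
  rw [Real.volume_closedBall, Real.volume_closedBall]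
  rcases le_total 0 r with hr | hr
  · rw [← ENNReal.ofReal_add (by linarith) (by linarith)]
    apply ENNReal.ofReal_le_ofReal
    linarith
  · rw [ENNReal.ofReal_of_nonpos (by linarith)]
    simp

/-- Pointwise form of `exists_lintegral_nearResonant_le`: near resonance either both frequencies are
bounded by a power of `μ`, or they are comparable and `|y|` lies within `64 μ ⟨x⟩ ^ (-3/2)` of
`|x|`. -/
theorem nearResonant_cases {a b p μ x y : ℝ} (hab : a + b = 3 / 2) (hp : 0 < p) (hpa : p ≤ 4 - a)
    (hpb : p ≤ 4 - b) (hp' : p ≤ 5 / 2) (hμ : 1 ≤ μ)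
    (h : |x ^ 4 - y ^ 4| ≤ μ * (japaneseBracket x ^ a * japaneseBracket y ^ b)) :
    (|y| ≤ (2 * μ) ^ p⁻¹ ∧
        japaneseBracket x ^ a * japaneseBracket y ^ b ≤ ((2 * μ) ^ p⁻¹) ^ 4) ∨
      (|(|x| - |y|)| ≤ 64 * μ * japaneseBracket x ^ (-(3 / 2) : ℝ) ∧
        japaneseBracket x ^ a * japaneseBracket y ^ b ≤ 16 * japaneseBracket x ^ (3 / 2 : ℝ)) := by
  have hX := one_le_japaneseBracket x
  have hY := one_le_japaneseBracket y
  have hX2 := sq_japaneseBracket x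
  have hY2 := sq_japaneseBracket y
  have hyY := abs_le_japaneseBracket y
  set X := japaneseBracket x
  set Y := japaneseBracket y
  have hX0 : 0 < X := by linarith
  have hx2 : x ^ 2 = X ^ 2 - 1 := by linarith
  have hy2 : y ^ 2 = Y ^ 2 - 1 := by linarith
  have h4 : x ^ 4 - y ^ 4 = (X ^ 2 - Y ^ 2) * (X ^ 2 + Y ^ 2 - 2) := by
    linear_combination (x ^ 2 + X ^ 2 - 1) * hx2 - (y ^ 2 + Y ^ 2 - 1) * hy2
  -- Brackets at distance a factor of two: the resonance factor is at least half the larger one to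
  -- the fourth power.
  by_cases hc1 : 2 * X ≤ Y
  · left
    have hXY : 4 * X ^ 2 ≤ Y ^ 2 := by nlinarith
    have hbig : Y ^ 4 ≤ 2 * μ * (X ^ a * Y ^ b) := by
      have := (neg_abs_le (x ^ 4 - y ^ 4))
      rw [h4] at this h
      nlinarith
    have := le_rpow_inv_of_pow_four_le hab hp hpb hp' hX (by linarith) hbig hμ
    exact ⟨hyY.trans this.1, this.2⟩
  by_cases hc2 : 2 * Y ≤ X
  · left
    have hXY : 4 * Y ^ 2 ≤ X ^ 2 := by nlinarith
    have hbig : X ^ 4 ≤ 2 * μ * (Y ^ b * X ^ a) := by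
      have := (le_abs_self (x ^ 4 - y ^ 4))
      rw [h4] at this h
      nlinarith
    have := le_rpow_inv_of_pow_four_le ((add_comm b a).trans hab) hp hpa hp' hY
      (by linarith) hbig hμ
    exact ⟨hyY.trans (le_trans (by linarith) this.1), by rw [mul_comm]; exact this.2⟩
  right
  have hm := rpow_mul_rpow_le_of_comparable (X := X) (Y := Y) hab (by linarith) (by linarith) hX0
    (by linarith) (by linarith)
  refine ⟨?_, hm⟩
  have hXp : 0 < X ^ (3 / 2 : ℝ) := Real.rpow_pos_of_pos hX0 _
  rw [Real.rpow_neg hX0.le, ← div_eq_mul_inv, le_div_iff₀ hXp]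
  -- For `|x| ≥ 1` the factor `|x| ^ 3 ∼ X ^ 3` divides out of the resonance factor; for `|x| ≤ 1`
  -- everything is bounded.
  rcases le_total 1 |x| with hx | hx
  · have hsq : X ^ (3 / 2 : ℝ) * X ^ (3 / 2 : ℝ) = X ^ 3 := by
      rw [← Real.rpow_add hX0, ← Real.rpow_natCast]
      norm_num
    have hX3 : X ^ 3 ≤ 4 * |x| ^ 3 := by
      have : X ≤ 3 / 2 * |x| := by
        apply abs_le_of_sq_le_sq' _ (by positivity) |>.2
        rw [mul_pow, sq_abs]
        nlinarith [sq_abs x]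
      calc X ^ 3 ≤ (3 / 2 * |x|) ^ 3 := by gcongr
        _ ≤ _ := by
          rw [mul_pow]
          gcongr
          norm_num
    have hdiff : |(|x| - |y|)| * |x| ^ 3 ≤ |x ^ 4 - y ^ 4| := by
      have e : x ^ 4 - y ^ 4 = (|x| - |y|) * ((|x| + |y|) * (|x| ^ 2 + |y| ^ 2)) := by
        rw [sq_abs, sq_abs, show (|x| - |y|) * ((|x| + |y|) * (x ^ 2 + y ^ 2))
          = (|x| ^ 2 - |y| ^ 2) * (x ^ 2 + y ^ 2) by ring, sq_abs, sq_abs]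
        ring
      rw [e, abs_mul, abs_of_nonneg (a := (|x| + |y|) * (|x| ^ 2 + |y| ^ 2)) (by positivity)]
      gcongr
      have := abs_nonneg x
      have := abs_nonneg y
      nlinarith [mul_nonneg (abs_nonneg x) (abs_nonneg y), sq_nonneg |x|,
        mul_nonneg (abs_nonneg x) (sq_nonneg |y|), mul_nonneg (abs_nonneg y) (sq_nonneg |x|),
        mul_nonneg (abs_nonneg y) (sq_nonneg |y|)]
    have hμm : μ * (X ^ a * Y ^ b) ≤ μ * (16 * X ^ (3 / 2 : ℝ)) := by gcongr
    refine le_of_mul_le_mul_right ?_ hXp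
    calc |(|x| - |y|)| * X ^ (3 / 2 : ℝ) * X ^ (3 / 2 : ℝ) = |(|x| - |y|)| * X ^ 3 := by
          rw [mul_assoc, hsq]
      _ ≤ |(|x| - |y|)| * (4 * |x| ^ 3) := by gcongr
      _ ≤ 64 * μ * X ^ (3 / 2 : ℝ) := by linarith
  · have hx1 : x ^ 2 ≤ 1 := by rwa [sq_le_one_iff_abs_le_one]
    have hX32 : X ^ (3 / 2 : ℝ) ≤ 2 := by
      calc X ^ (3 / 2 : ℝ) ≤ X ^ (2 : ℝ) := Real.rpow_le_rpow_of_exponent_le hX (by norm_num)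
        _ = X ^ 2 := by rw [← Real.rpow_natCast]; norm_num
        _ ≤ 2 := by linarith
    have hXle : X ≤ 3 / 2 := by nlinarith
    have hd : |(|x| - |y|)| ≤ 3 := by
      rw [abs_le]
      constructor <;> linarith [abs_nonneg x, abs_nonneg y]
    calc |(|x| - |y|)| * X ^ (3 / 2 : ℝ) ≤ 3 * 2 := by gcongr
      _ ≤ _ := by linarith

/-- The squared frequency weight `⟨x⟩ ^ a ⟨y⟩ ^ b` has integral in `y` at most a power of `μ` over
the set where the resonance factor `|x ^ 4 - y ^ 4|` is at most `μ` times the weight, uniformly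
in `x`. -/
theorem exists_lintegral_nearResonant_le {a b : ℝ} (hab : a + b = 3 / 2) (ha : a < 4)
    (hb : b < 4) :
    ∃ C N : ℝ, 0 < N ∧ ∀ x μ : ℝ, 1 ≤ μ →
      ∫⁻ y in {y : ℝ | |x ^ 4 - y ^ 4| ≤ μ * (japaneseBracket x ^ a * japaneseBracket y ^ b)},
        ENNReal.ofReal (japaneseBracket x ^ a * japaneseBracket y ^ b)
      ≤ ENNReal.ofReal (C * μ ^ N) := by
  set p := min (min (4 - a) (4 - b)) (5 / 2) with hpdef
  have hp : 0 < p := by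
    simp only [hpdef, lt_min_iff]
    refine ⟨⟨?_, ?_⟩, ?_⟩ <;> linarith
  have hpa : p ≤ 4 - a := (min_le_left _ _).trans (min_le_left _ _)
  have hpb : p ≤ 4 - b := (min_le_left _ _).trans (min_le_right _ _)
  have hp' : p ≤ 5 / 2 := min_le_right _ _
  refine ⟨2 * 2 ^ (p⁻¹ * 5) + 4096, p⁻¹ * 5, by positivity, fun x μ hμ => ?_⟩
  set R := (2 * μ) ^ p⁻¹ with hR
  have hR0 : 0 < R := by positivity
  set X := japaneseBracket x with hXdef
  have hX0 : 0 < X := japaneseBracket_pos x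
  set s := {y : ℝ | |x ^ 4 - y ^ 4| ≤ μ * (X ^ a * japaneseBracket y ^ b)}
  set s₁ : Set ℝ := Metric.closedBall 0 R
  set s₂ := {y : ℝ | |(|x| - |y|)| ≤ 64 * μ * X ^ (-(3 / 2) : ℝ)}
  set f : ℝ → ℝ≥0∞ := fun y => ENNReal.ofReal (X ^ a * japaneseBracket y ^ b) with hf
  have hs : MeasurableSet s := measurableSet_le (by fun_prop) (by fun_prop)
  have hs₁ : MeasurableSet s₁ := Metric.isClosed_closedBall.measurableSet
  have hs₂ : MeasurableSet s₂ := measurableSet_le (by fun_prop) (by fun_prop)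
  have hpt : ∀ y, s.indicator f y ≤ s₁.indicator (fun _ => ENNReal.ofReal (R ^ 4)) y
      + s₂.indicator (fun _ => ENNReal.ofReal (16 * X ^ (3 / 2 : ℝ))) y := by
    intro y
    by_cases hy : y ∈ s
    · rw [Set.indicator_of_mem hy]
      rcases nearResonant_cases hab hp hpa hpb hp' hμ hy with ⟨h1, h2⟩ | ⟨h1, h2⟩
      · have : y ∈ s₁ := by simpa [s₁] using h1
        rw [Set.indicator_of_mem this]
        exact le_add_right (ENNReal.ofReal_le_ofReal h2)
      · have : y ∈ s₂ := h1
        rw [Set.indicator_of_mem this]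
        exact le_add_left (ENNReal.ofReal_le_ofReal h2)
    · rw [Set.indicator_of_notMem hy]
      exact zero_le
  have hμN : μ ≤ μ ^ (p⁻¹ * 5) := by
    nth_rw 1 [← Real.rpow_one μ]
    apply Real.rpow_le_rpow_of_exponent_le hμ
    rw [← div_eq_inv_mul, le_div_iff₀ hp]
    linarith
  calc ∫⁻ y in s, f y = ∫⁻ y, s.indicator f y := (lintegral_indicator hs _).symm
    _ ≤ _ := lintegral_mono hpt
    _ = ENNReal.ofReal (R ^ 4) * volume s₁
        + ENNReal.ofReal (16 * X ^ (3 / 2 : ℝ)) * volume s₂ := by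
      rw [lintegral_add_left (measurable_const.indicator hs₁), lintegral_indicator_const hs₁,
        lintegral_indicator_const hs₂]
    _ ≤ ENNReal.ofReal (R ^ 4) * ENNReal.ofReal (2 * R)
        + ENNReal.ofReal (16 * X ^ (3 / 2 : ℝ))
          * ENNReal.ofReal (4 * (64 * μ * X ^ (-(3 / 2) : ℝ))) := by
      gcongr
      · exact (Real.volume_closedBall 0 R).le
      · exact volume_abs_sub_abs_le _ _
    _ = ENNReal.ofReal (2 * R ^ 5 + 4096 * μ) := by
      rw [← ENNReal.ofReal_mul (by positivity), ← ENNReal.ofReal_mul (by positivity),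
        ← ENNReal.ofReal_add (by positivity) (by positivity)]
      congr 1
      have : X ^ (3 / 2 : ℝ) * X ^ (-(3 / 2) : ℝ) = 1 := by
        rw [← Real.rpow_add hX0]
        norm_num
      linear_combination 4096 * μ * this
    _ ≤ _ := by
      apply ENNReal.ofReal_le_ofReal
      have hR5 : R ^ 5 = 2 ^ (p⁻¹ * 5) * μ ^ (p⁻¹ * 5) := by
        rw [hR, ← Real.rpow_natCast, ← Real.rpow_mul (by positivity),
          Real.mul_rpow (by norm_num) (by linarith)]
        norm_num
      rw [hR5]
      linarith

/-! ### The Fourier side -/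

theorem sq_eLpNorm_two {X E : Type*} [MeasurableSpace X] [NormedAddCommGroup E] (μ : Measure X)
    (f : X → E) : eLpNorm f 2 μ ^ 2 = ∫⁻ x, ‖f x‖ₑ ^ 2 ∂μ := by
  have := eLpNorm_nnreal_pow_eq_lintegral (μ := μ) (f := f) (p := 2) (by norm_num)
  simpa using this

theorem SchwartzMap.eLpNorm_fourier_two {V : Type*} [NormedAddCommGroup V] [InnerProductSpace ℝ V]
    [FiniteDimensional ℝ V] [MeasurableSpace V] [BorelSpace V] (f : 𝓢(V, ℂ)) :
    eLpNorm (𝓕 f : 𝓢(V, ℂ)) 2 volume = eLpNorm f 2 volume := by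
  have h := norm_fourier_toL2_eq (V := V) (H := ℂ) f
  rw [norm_toLp, norm_toLp] at h
  exact (ENNReal.toReal_eq_toReal_iff' ((𝓕 f).memLp 2 volume).eLpNorm_ne_top
    (f.memLp 2 volume).eLpNorm_ne_top).1 h

/-- The Euclidean plane, mapped onto `ℝ × ℝ` by `x ↦ -2πx`. The sup norm of
`ℝ × ℝ` does not come from an inner product, and Mathlib's Fourier transform of Schwartz functions
needs one. Pulling back by this map turns the inverse Fourier transform, whose kernel is
`e^{2πi⟨x, k⟩}`, into a multiple of `spaceTimeFourier`. -/
def planeScaling : WithLp 2 (ℝ × ℝ) ≃L[ℝ] ℝ × ℝ :=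
  (WithLp.prodContinuousLinearEquiv 2 ℝ ℝ ℝ).trans
    (ContinuousLinearEquiv.smulLeft (Units.mk0 (-(2 * Real.pi)) (by simp [Real.pi_ne_zero])))

theorem planeScaling_apply (x : WithLp 2 (ℝ × ℝ)) :
    planeScaling x = (-(2 * Real.pi)) • WithLp.ofLp x := rfl

/-- The Jacobian constant `(2π)⁻²` of `planeScaling`. -/
def planeConst : ℝ := ((2 * Real.pi) ^ 2)⁻¹

theorem planeConst_pos : 0 < planeConst := by unfold planeConst; positivity

theorem map_planeScaling :
    Measure.map planeScaling volume
      = ENNReal.ofReal planeConst • (volume : Measure (ℝ × ℝ)) := by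
  have h := Measure.map_addHaar_smul (volume : Measure (ℝ × ℝ)) (r := -(2 * Real.pi))
    (by simp [Real.pi_ne_zero])
  have h2 := (WithLp.volume_preserving_ofLp ℝ ℝ).map_eq
  rw [show (planeScaling : WithLp 2 (ℝ × ℝ) → ℝ × ℝ)
      = (fun y : ℝ × ℝ => (-(2 * Real.pi)) • y) ∘ WithLp.ofLp from rfl,
    ← Measure.map_map (by fun_prop) (WithLp.volume_preserving_ofLp ℝ ℝ).measurable, h2, h]
  congr 2
  rw [show Module.finrank ℝ (ℝ × ℝ) = 2 by simp]
  rw [planeConst, neg_sq, abs_of_pos (by positivity)]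

theorem integral_comp_planeScaling (f : ℝ × ℝ → ℂ) :
    ∫ x, f (planeScaling x) = planeConst • ∫ p, f p := by
  have h := integral_map_equiv (μ := volume) planeScaling.toHomeomorph.toMeasurableEquiv f
  have e : Measure.map planeScaling.toHomeomorph.toMeasurableEquiv volume
      = ENNReal.ofReal planeConst • (volume : Measure (ℝ × ℝ)) := map_planeScaling
  rw [e, integral_smul_measure, ENNReal.toReal_ofReal planeConst_pos.le] at h
  exact h.symm

/-- Pullback of a Schwartz function to the Euclidean plane by `planeScaling`. -/
def planePullback (u : 𝓢(ℝ × ℝ, ℂ)) : 𝓢(WithLp 2 (ℝ × ℝ), ℂ) :=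
  SchwartzMap.compCLMOfContinuousLinearEquiv ℝ planeScaling u

theorem planePullback_apply (u : 𝓢(ℝ × ℝ, ℂ)) (x : WithLp 2 (ℝ × ℝ)) :
    planePullback u x = u (planeScaling x) := rfl

theorem fourierInv_planePullback (u : 𝓢(ℝ × ℝ, ℂ)) (k : WithLp 2 (ℝ × ℝ)) :
    𝓕⁻ (planePullback u) k = planeConst • spaceTimeFourier u (WithLp.ofLp k) := by
  rw [SchwartzMap.fourierInv_coe, Real.fourierInv_eq', spaceTimeFourier,
    ← integral_comp_planeScaling]
  refine integral_congr_ae (Filter.Eventually.of_forall fun x => ?_)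
  simp only [planePullback_apply, smul_eq_mul, planeScaling_apply, WithLp.prod_inner_apply]
  congr 2
  simp
  ring

theorem measurable_spaceTimeFourier (u : 𝓢(ℝ × ℝ, ℂ)) : Measurable (spaceTimeFourier u) := by
  have h : spaceTimeFourier u = fun q => planeConst⁻¹ • 𝓕⁻ (planePullback u) (WithLp.toLp 2 q) := by
    ext q
    rw [fourierInv_planePullback, smul_smul, inv_mul_cancel₀ planeConst_pos.ne', one_smul]
  rw [h]
  have h1 : Measurable (𝓕⁻ (planePullback u) : 𝓢(WithLp 2 (ℝ × ℝ), ℂ)) :=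
    (𝓕⁻ (planePullback u) : 𝓢(WithLp 2 (ℝ × ℝ), ℂ)).continuous.measurable
  have h2 := (WithLp.volume_preserving_toLp ℝ ℝ).measurable
  exact (h1.comp h2).const_smul planeConst⁻¹

attribute [fun_prop] measurable_spaceTimeFourier

/-- Plancherel's theorem and the convolution theorem, as an inequality between nonnegative
functions: the `L²` norm of a product is controlled by that of the convolution of the absolute
values of the Fourier transforms. -/
theorem exists_sq_eLpNorm_mul_le :
    ∃ c : ℝ≥0, ∀ u v : 𝓢(ℝ × ℝ, ℂ),
      eLpNorm (fun p => u p * v p) 2 volume ^ 2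
        ≤ c * ∫⁻ q, (∫⁻ q', ‖spaceTimeFourier u (q - q')‖ₑ * ‖spaceTimeFourier v q'‖ₑ) ^ 2 := by
  set a : ℝ≥0∞ := ENNReal.ofReal planeConst with ha
  have ha0 : a ≠ 0 := by simpa [ha] using planeConst_pos
  have hat : a ≠ ⊤ := ENNReal.ofReal_ne_top
  refine ⟨(a⁻¹ * (a * a) ^ 2).toNNReal, fun u v => ?_⟩
  rw [ENNReal.coe_toNNReal (by finiteness)]
  set U := planePullback u with hU
  set W := planePullback v with hW
  set B := ContinuousLinearMap.mul ℂ ℂ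
  have hvol : a * ∫⁻ p, ‖u p * v p‖ₑ ^ 2 = ∫⁻ x, ‖U x * W x‖ₑ ^ 2 := by
    have h := lintegral_map_equiv (μ := volume) (fun p => ‖u p * v p‖ₑ ^ 2)
      planeScaling.toHomeomorph.toMeasurableEquiv
    have e : Measure.map planeScaling.toHomeomorph.toMeasurableEquiv volume
        = a • (volume : Measure (ℝ × ℝ)) := map_planeScaling
    rw [e, lintegral_smul_measure] at h
    exact h
  -- `Z` is the inverse Fourier transform of `U * W`.
  set Z : 𝓢(WithLp 2 (ℝ × ℝ), ℂ) := SchwartzMap.convolution B (𝓕⁻ W) (𝓕⁻ U) with hZ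
  have hFZ : ∀ x, 𝓕 Z x = U x * W x := by
    intro x
    rw [hZ, SchwartzMap.fourier_convolution, SchwartzMap.pairing_apply_apply]
    simp [B, mul_comm]
  have hZle : ∀ k, ‖Z k‖ₑ ≤ (a * a)
      * ∫⁻ q', ‖spaceTimeFourier u (WithLp.ofLp k - q')‖ₑ * ‖spaceTimeFourier v q'‖ₑ := by
    intro k
    rw [hZ, SchwartzMap.convolution_apply]
    refine (enorm_integral_le_lintegral_enorm _).trans (le_of_eq ?_)
    have hmp := WithLp.volume_preserving_ofLp ℝ ℝ
    rw [← lintegral_const_mul _ (by fun_prop), ← hmp.lintegral_comp (by fun_prop)]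
    refine lintegral_congr fun t => ?_
    rw [fourierInv_planePullback, fourierInv_planePullback]
    simp only [B, ContinuousLinearMap.mul_apply', enorm_mul, enorm_smul, WithLp.ofLp_sub]
    rw [Real.enorm_of_nonneg planeConst_pos.le]
    ring
  calc eLpNorm (fun p => u p * v p) 2 volume ^ 2 = ∫⁻ p, ‖u p * v p‖ₑ ^ 2 := sq_eLpNorm_two _ _
    _ = a⁻¹ * ∫⁻ x, ‖U x * W x‖ₑ ^ 2 := by
      rw [← hvol, ← mul_assoc, ENNReal.inv_mul_cancel ha0 hat, one_mul]
    _ = a⁻¹ * ∫⁻ k, ‖Z k‖ₑ ^ 2 := by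
      simp_rw [← hFZ]
      rw [← sq_eLpNorm_two volume (𝓕 Z : 𝓢(WithLp 2 (ℝ × ℝ), ℂ)),
        SchwartzMap.eLpNorm_fourier_two, sq_eLpNorm_two]
    _ ≤ a⁻¹ * ∫⁻ k : WithLp 2 (ℝ × ℝ), ((a * a) * ∫⁻ q', ‖spaceTimeFourier u (WithLp.ofLp k - q')‖ₑ
        * ‖spaceTimeFourier v q'‖ₑ) ^ 2 := by
      gcongr with k
      exact hZle k
    _ = _ := by
      have hmp := WithLp.volume_preserving_ofLp ℝ ℝ
      simp_rw [mul_pow (a * a)]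
      rw [hmp.lintegral_comp (f := fun q => (a * a) ^ 2 * (∫⁻ q', ‖spaceTimeFourier u (q - q')‖ₑ
        * ‖spaceTimeFourier v q'‖ₑ) ^ 2) (by fun_prop), lintegral_const_mul _ (by fun_prop),
        mul_assoc]

/-! ### Bourgain weights -/

/-- The weight `⟨ξ⟩ ^ s ⟨τ - ξ ^ 5⟩ ^ b` of the Bourgain norm. -/
def bourgainWeight (s b : ℝ) (q : ℝ × ℝ) : ℝ :=
  japaneseBracket q.2 ^ s * japaneseBracket (q.1 - q.2 ^ 5) ^ b

theorem bourgainWeight_pos (s b : ℝ) (q : ℝ × ℝ) : 0 < bourgainWeight s b q :=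
  mul_pos (Real.rpow_pos_of_pos (japaneseBracket_pos _) _)
    (Real.rpow_pos_of_pos (japaneseBracket_pos _) _)

theorem measurable_bourgainWeight (s b : ℝ) : Measurable (bourgainWeight s b) := by
  unfold bourgainWeight
  fun_prop

attribute [fun_prop] measurable_bourgainWeight

theorem bourgainWeight_neg_mul (s b : ℝ) (q : ℝ × ℝ) :
    bourgainWeight (-s) (-b) q * bourgainWeight s b q = 1 := by
  have h1 := (Real.rpow_pos_of_pos (japaneseBracket_pos q.2) s).ne'
  have h2 := (Real.rpow_pos_of_pos (japaneseBracket_pos (q.1 - q.2 ^ 5)) b).ne'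
  rw [bourgainWeight, bourgainWeight, Real.rpow_neg (japaneseBracket_pos _).le,
    Real.rpow_neg (japaneseBracket_pos _).le]
  field_simp

theorem sq_bourgainWeight (s b : ℝ) (q : ℝ × ℝ) :
    bourgainWeight s b q ^ 2 = bourgainWeight (2 * s) (2 * b) q := by
  simp only [bourgainWeight, mul_pow]
  congr 1 <;>
  · rw [← Real.rpow_natCast, ← Real.rpow_mul (japaneseBracket_pos _).le]
    congr 1
    push_cast
    ring

theorem bourgainNorm_eq (s b : ℝ) (u : ℝ × ℝ → ℂ) :
    bourgainNorm s b u ^ 2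
      = ∫⁻ q, (ENNReal.ofReal (bourgainWeight s b q) * ‖spaceTimeFourier u q‖ₑ) ^ 2 := by
  rw [bourgainNorm, sq_eLpNorm_two]
  refine lintegral_congr fun q => ?_
  rw [enorm_mul, ← Real.enorm_of_nonneg (bourgainWeight_pos s b q).le]
  congr 2
  rw [← ofReal_norm, ← ofReal_norm, Complex.norm_real]
  rfl

theorem bourgainNorm_mono_left {s s' : ℝ} (h : s ≤ s') (b : ℝ) (u : ℝ × ℝ → ℂ) :
    bourgainNorm s b u ≤ bourgainNorm s' b u := by
  have : bourgainNorm s b u ^ 2 ≤ bourgainNorm s' b u ^ 2 := by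
    rw [bourgainNorm_eq, bourgainNorm_eq]
    gcongr with q
    have h1 := (Real.rpow_pos_of_pos (japaneseBracket_pos (q.1 - q.2 ^ 5)) b).le
    unfold bourgainWeight
    gcongr
    exact one_le_japaneseBracket _
  exact (ENNReal.pow_le_pow_left_iff two_ne_zero).1 this

theorem BilinearL2Estimate.mono {ε s₁ s₂ s₁' s₂' : ℝ} (h : BilinearL2Estimate ε s₁ s₂)
    (h₁ : s₁ ≤ s₁') (h₂ : s₂ ≤ s₂') : BilinearL2Estimate ε s₁' s₂' := by
  obtain ⟨C, hC⟩ := h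
  refine ⟨C, fun u v => (hC u v).trans ?_⟩
  gcongr
  · exact bourgainNorm_mono_left h₁ _ _
  · exact bourgainNorm_mono_left h₂ _ _

/-! ### The two kernel estimates -/

/-- The multiplier `⟨ξ₁⟩ ^ α ⟨σ₁⟩ ^ (-(1/2 - ε)) ⟨ξ₂⟩ ^ (3/4 - α) ⟨σ₂⟩ ^ (-(1/2 + ε))`, with
`σⱼ = τⱼ - ξⱼ ^ 5`, that is left of the two Bourgain weights in the endpoint case
`β = α - 3 / 4`. -/
def bilinearKernel (α ε : ℝ) (z : (ℝ × ℝ) × (ℝ × ℝ)) : ℝ≥0∞ :=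
  ENNReal.ofReal
    (bourgainWeight α (-(1 / 2 - ε)) z.1 * bourgainWeight (3 / 4 - α) (-(1 / 2 + ε)) z.2)

/-- The frequency pairs whose resonance factor `|ξ₁ ^ 4 - ξ₂ ^ 4|` is at most `⟨σ₁⟩ ^ (4ε)` times
the square `⟨ξ₁⟩ ^ (2α) ⟨ξ₂⟩ ^ (3/2 - 2α)` of the frequency weight. -/
def nearResonantSet (α ε : ℝ) : Set ((ℝ × ℝ) × (ℝ × ℝ)) :=
  {z | |z.1.2 ^ 4 - z.2.2 ^ 4| ≤ japaneseBracket (z.1.1 - z.1.2 ^ 5) ^ (4 * ε)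
    * (japaneseBracket z.1.2 ^ (2 * α) * japaneseBracket z.2.2 ^ (3 / 2 - 2 * α))}

theorem measurable_bilinearKernel (α ε : ℝ) : Measurable (bilinearKernel α ε) := by
  unfold bilinearKernel
  fun_prop

theorem measurableSet_nearResonantSet (α ε : ℝ) : MeasurableSet (nearResonantSet α ε) :=
  measurableSet_le (by fun_prop) (by fun_prop)

theorem sq_bilinearKernel (α ε : ℝ) (z : (ℝ × ℝ) × (ℝ × ℝ)) :
    bilinearKernel α ε z ^ 2 = ENNReal.ofReal
      (japaneseBracket z.1.2 ^ (2 * α) * japaneseBracket z.2.2 ^ (3 / 2 - 2 * α)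
        * japaneseBracket (z.1.1 - z.1.2 ^ 5) ^ (-(1 - 2 * ε))
        * japaneseBracket (z.2.1 - z.2.2 ^ 5) ^ (-(1 + 2 * ε))) := by
  have hw := fun s b q => (bourgainWeight_pos s b q).le
  rw [bilinearKernel, ← ENNReal.ofReal_pow (mul_nonneg (hw _ _ _) (hw _ _ _)), mul_pow,
    sq_bourgainWeight, sq_bourgainWeight,
    bourgainWeight, bourgainWeight]
  congr 1
  rw [show 2 * -(1 / 2 - ε) = -(1 - 2 * ε) by ring, show 2 * -(1 / 2 + ε) = -(1 + 2 * ε) by ring,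
    show 2 * (3 / 4 - α) = 3 / 2 - 2 * α by ring]
  ring

/-- The integral in `(τ₂, ξ₂)` of a function of `ξ₂` times one of the modulation
`τ₂ - ξ₂ ^ 5` factors. -/
theorem lintegral_mul_modulation {f g : ℝ → ℝ≥0∞} (hf : Measurable f) (hg : Measurable g) :
    ∫⁻ q : ℝ × ℝ, f q.2 * g (q.1 - q.2 ^ 5) = (∫⁻ x, f x) * ∫⁻ s, g s := by
  rw [Measure.volume_eq_prod, lintegral_prod_symm _ (by fun_prop)]
  calc _ = ∫⁻ x, f x * ∫⁻ s, g s := by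
        refine lintegral_congr fun x => ?_
        dsimp only
        rw [lintegral_const_mul _ (by fun_prop)]
        congr 1
        exact lintegral_sub_right_eq_self g (x ^ 5)
    _ = _ := lintegral_mul_const _ hf

/-- The near-resonant part of the kernel is square integrable in the second frequency, uniformly in
the first one. -/
theorem exists_lintegral_nearResonant_kernel_le {α : ℝ} (h1 : -(5 / 4) < α) (h2 : α < 2) :
    ∃ ε₀ : ℝ, 0 < ε₀ ∧ ∀ ε : ℝ, 0 < ε → ε < ε₀ → ∃ A : ℝ≥0, ∀ p : ℝ × ℝ,
      ∫⁻ q', (nearResonantSet α ε).indicator (bilinearKernel α ε) (p, q') ^ 2 ≤ A := by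
  obtain ⟨C, N, hN, hCN⟩ := exists_lintegral_nearResonant_le (a := 2 * α) (b := 3 / 2 - 2 * α)
    (by ring) (by linarith) (by linarith)
  -- The threshold makes `μ ^ N`, with `μ = ⟨σ₁⟩ ^ (4ε)`, at most `⟨σ₁⟩ ^ (1 - 2ε)`.
  refine ⟨(4 * N + 2)⁻¹, by positivity, fun ε hε hlt => ?_⟩
  have hεN : 4 * ε * N ≤ 1 - 2 * ε := by
    have := mul_lt_mul_of_pos_right hlt (show 0 < 4 * N + 2 by positivity)
    rw [inv_mul_cancel₀ (by positivity)] at this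
    linarith
  set I := ∫⁻ x : ℝ, ENNReal.ofReal (japaneseBracket x ^ (-(1 + 2 * ε))) with hI
  have hIfin : I < ⊤ := lintegral_japaneseBracket_rpow_lt_top (by linarith)
  -- `max C 0` only serves to have a nonnegative constant.
  refine ⟨(ENNReal.ofReal (max C 0) * I).toNNReal, fun p => ?_⟩
  rw [ENNReal.coe_toNNReal (by finiteness)]
  set M₁ := japaneseBracket (p.1 - p.2 ^ 5) with hM
  have hM1 : 1 ≤ M₁ := one_le_japaneseBracket _
  have hM0 : 0 < M₁ := by linarith
  set T := {y : ℝ | |p.2 ^ 4 - y ^ 4| ≤ M₁ ^ (4 * ε)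
    * (japaneseBracket p.2 ^ (2 * α) * japaneseBracket y ^ (3 / 2 - 2 * α))} with hT
  have hTm : MeasurableSet T := measurableSet_le (by fun_prop) (by fun_prop)
  set m : ℝ → ℝ≥0∞ := fun y => ENNReal.ofReal
    (japaneseBracket p.2 ^ (2 * α) * japaneseBracket y ^ (3 / 2 - 2 * α)) with hm
  have hmm : Measurable m := by fun_prop
  have hmT := hmm.indicator hTm
  have hpt : ∀ q' : ℝ × ℝ, (nearResonantSet α ε).indicator (bilinearKernel α ε) (p, q') ^ 2
      = ENNReal.ofReal (M₁ ^ (-(1 - 2 * ε))) * (T.indicator m q'.2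
        * ENNReal.ofReal (japaneseBracket (q'.1 - q'.2 ^ 5) ^ (-(1 + 2 * ε)))) := by
    intro q'
    by_cases hq : q'.2 ∈ T
    · have hq2 : (p, q') ∈ nearResonantSet α ε := hq
      have := japaneseBracket_pos
      rw [Set.indicator_of_mem hq, Set.indicator_of_mem hq2, sq_bilinearKernel, hm]
      have h3 := (Real.rpow_pos_of_pos (this p.2) (2 * α)).le
      have h4 := (Real.rpow_pos_of_pos (this q'.2) (3 / 2 - 2 * α)).le
      rw [← ENNReal.ofReal_mul (mul_nonneg h3 h4), ← ENNReal.ofReal_mul (by positivity)]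
      congr 1
      ring
    · have hq2 : (p, q') ∉ nearResonantSet α ε := hq
      rw [Set.indicator_of_notMem hq, Set.indicator_of_notMem hq2]
      simp
  calc _ = ENNReal.ofReal (M₁ ^ (-(1 - 2 * ε))) * ((∫⁻ y in T, m y) * I) := by
        rw [lintegral_congr hpt, lintegral_const_mul _ (by fun_prop),
          lintegral_mul_modulation
            (g := fun s => ENNReal.ofReal (japaneseBracket s ^ (-(1 + 2 * ε))))
            hmT (by fun_prop), lintegral_indicator hTm]
    _ ≤ ENNReal.ofReal (M₁ ^ (-(1 - 2 * ε)))
        * (ENNReal.ofReal (max C 0 * M₁ ^ (1 - 2 * ε)) * I) := by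
        gcongr
        refine (hCN p.2 (M₁ ^ (4 * ε)) (Real.one_le_rpow hM1 (by linarith))).trans ?_
        apply ENNReal.ofReal_le_ofReal
        rw [← Real.rpow_mul hM0.le]
        gcongr
        exact le_max_left _ _
    _ = _ := by
        rw [← mul_assoc, ← ENNReal.ofReal_mul (by positivity)]
        congr 2
        have : M₁ ^ (-(1 - 2 * ε)) * M₁ ^ (1 - 2 * ε) = 1 := by
          rw [← Real.rpow_add hM0]
          simp
        linear_combination (max C 0) * this

/-- The non-resonant part of the kernel is square integrable over the pairs of frequencies with a
given sum, uniformly in the sum. -/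
theorem exists_lintegral_nonResonant_kernel_le (α : ℝ) {ε : ℝ} (hε : 0 < ε) :
    ∃ B : ℝ≥0, ∀ q : ℝ × ℝ,
      ∫⁻ q', (nearResonantSet α ε)ᶜ.indicator (bilinearKernel α ε) (q - q', q') ^ 2 ≤ B := by
  set J : ℝ → ℝ≥0∞ := fun x => ENNReal.ofReal (japaneseBracket x ^ (-(1 + 2 * ε))) with hJ
  have hJm : Measurable J := by fun_prop
  set I := ∫⁻ x : ℝ, J x with hI
  have hIfin : I < ⊤ := lintegral_japaneseBracket_rpow_lt_top (by linarith)
  refine ⟨(2 * I * I).toNNReal, fun q => ?_⟩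
  rw [ENNReal.coe_toNNReal (by finiteness)]
  have hpt : ∀ q' : ℝ × ℝ, (nearResonantSet α ε)ᶜ.indicator (bilinearKernel α ε) (q - q', q') ^ 2
      ≤ ENNReal.ofReal |q'.2 ^ 4 - (q.2 - q'.2) ^ 4| * J (q.1 - q'.1 - (q.2 - q'.2) ^ 5)
        * J (q'.1 - q'.2 ^ 5) := by
    intro q'
    by_cases hq : (q - q', q') ∈ nearResonantSet α ε
    · rw [Set.indicator_of_notMem (by simpa using hq)]
      simp
    · rw [Set.indicator_of_mem hq, sq_bilinearKernel, hJ, ← ENNReal.ofReal_mul (abs_nonneg _),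
        ← ENNReal.ofReal_mul (mul_nonneg (abs_nonneg _)
          (Real.rpow_nonneg (japaneseBracket_pos _).le _))]
      apply ENNReal.ofReal_le_ofReal
      simp only [nearResonantSet, Set.mem_ofPred_eq, not_le, Prod.fst_sub, Prod.snd_sub] at hq ⊢
      set M₁ := japaneseBracket (q.1 - q'.1 - (q.2 - q'.2) ^ 5)
      have hM0 : 0 < M₁ := japaneseBracket_pos _
      set m := japaneseBracket (q.2 - q'.2) ^ (2 * α) * japaneseBracket q'.2 ^ (3 / 2 - 2 * α)
      have h2 := (Real.rpow_pos_of_pos (japaneseBracket_pos (q'.1 - q'.2 ^ 5)) (-(1 + 2 * ε))).le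
      have hexp : M₁ ^ (-(1 - 2 * ε)) = M₁ ^ (4 * ε) * M₁ ^ (-(1 + 2 * ε)) := by
        rw [← Real.rpow_add hM0]
        congr 1
        ring
      gcongr ?_ * _
      calc m * M₁ ^ (-(1 - 2 * ε)) = M₁ ^ (4 * ε) * m * M₁ ^ (-(1 + 2 * ε)) := by
            rw [hexp]
            ring
        _ ≤ _ := by
            rw [abs_sub_comm]
            gcongr
  calc _ ≤ _ := lintegral_mono hpt
    _ = ∫⁻ x, ∫⁻ t, ENNReal.ofReal |x ^ 4 - (q.2 - x) ^ 4| * J (q.1 - t - (q.2 - x) ^ 5)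
        * J (t - x ^ 5) := by
        rw [Measure.volume_eq_prod, lintegral_prod_symm _ (by fun_prop)]
    -- For fixed `x = ξ₂` the modulation `s = t - x ^ 5` replaces the variable `t = τ₂`.
    _ = ∫⁻ x, ∫⁻ s, ENNReal.ofReal |x ^ 4 - (q.2 - x) ^ 4|
        * J (q.1 - s - x ^ 5 - (q.2 - x) ^ 5) * J s := by
        refine lintegral_congr fun x => ?_
        rw [← lintegral_add_right_eq_self _ (x ^ 5)]
        refine lintegral_congr fun s => ?_
        rw [add_sub_cancel_right, sub_add_eq_sub_sub]
    _ = ∫⁻ s, (∫⁻ x, ENNReal.ofReal |x ^ 4 - (q.2 - x) ^ 4|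
        * J (q.1 - s - x ^ 5 - (q.2 - x) ^ 5)) * J s := by
        rw [lintegral_lintegral_swap (by fun_prop)]
        refine lintegral_congr fun s => ?_
        rw [lintegral_mul_const _ (by fun_prop)]
    _ ≤ ∫⁻ s, 2 * I * J s := by
        gcongr with s
        exact lintegral_resonance_le q.2 (q.1 - s) J
    _ = 2 * I * I := lintegral_const_mul _ hJm

/-! ### The bilinear estimates -/

theorem exists_bilinearL2Estimate_endpoint {α : ℝ} (h1 : -(5 / 4) < α) (h2 : α < 2) :
    ∃ ε₀ : ℝ, 0 < ε₀ ∧ ∀ ε : ℝ, 0 < ε → ε < ε₀ → BilinearL2Estimate ε (-α) (α - 3 / 4) := by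
  obtain ⟨ε₀, hε₀, hA⟩ := exists_lintegral_nearResonant_kernel_le h1 h2
  refine ⟨ε₀, hε₀, fun ε hε hlt => ?_⟩
  obtain ⟨A, hA⟩ := hA ε hε hlt
  obtain ⟨B, hB⟩ := exists_lintegral_nonResonant_kernel_le α hε
  obtain ⟨c, hc⟩ := exists_sq_eLpNorm_mul_le
  refine ⟨NNReal.sqrt (c * (2 * (A + B))), fun u v => ?_⟩
  set f : ℝ × ℝ → ℝ≥0∞ := fun q =>
    ENNReal.ofReal (bourgainWeight (-α) (1 / 2 - ε) q) * ‖spaceTimeFourier u q‖ₑ with hf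
  set g : ℝ × ℝ → ℝ≥0∞ := fun q =>
    ENNReal.ofReal (bourgainWeight (α - 3 / 4) (1 / 2 + ε) q) * ‖spaceTimeFourier v q‖ₑ with hg
  have hfm : Measurable f := by fun_prop
  have hgm : Measurable g := by fun_prop
  have hker : ∀ p q', ‖spaceTimeFourier u p‖ₑ * ‖spaceTimeFourier v q'‖ₑ
      = bilinearKernel α ε (p, q') * (f p * g q') := by
    intro p q'
    have e1 := bourgainWeight_neg_mul (-α) (1 / 2 - ε) p
    have e2 := bourgainWeight_neg_mul (α - 3 / 4) (1 / 2 + ε) q'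
    rw [neg_neg] at e1
    rw [neg_sub] at e2
    have hw := fun s b q => (bourgainWeight_pos s b q).le
    calc _ = ENNReal.ofReal (bourgainWeight α (-(1 / 2 - ε)) p * bourgainWeight (-α) (1 / 2 - ε) p)
          * ENNReal.ofReal (bourgainWeight (3 / 4 - α) (-(1 / 2 + ε)) q'
            * bourgainWeight (α - 3 / 4) (1 / 2 + ε) q')
          * (‖spaceTimeFourier u p‖ₑ * ‖spaceTimeFourier v q'‖ₑ) := by rw [e1, e2]; simp
      _ = _ := by
        rw [ENNReal.ofReal_mul (hw _ _ _), ENNReal.ofReal_mul (hw _ _ _), hf, hg,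
          bilinearKernel, ENNReal.ofReal_mul (hw _ _ _)]
        ring
  have hmain := lintegral_sq_kernel_le (measurable_bilinearKernel α ε)
    (measurableSet_nearResonantSet α ε) hA hB hfm hgm
  have hsq : eLpNorm (fun p : ℝ × ℝ => u p * v p) 2 volume ^ 2
      ≤ (NNReal.sqrt (c * (2 * (A + B))) * bourgainNorm (-α) (1 / 2 - ε) u
        * bourgainNorm (α - 3 / 4) (1 / 2 + ε) v) ^ 2 := by
    calc _ ≤ _ := hc u v
      _ ≤ c * (2 * (A + B) * ((∫⁻ p, f p ^ 2) * ∫⁻ p, g p ^ 2)) := by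
        simp_rw [hker]
        gcongr
      _ = _ := by
        rw [mul_pow, mul_pow, bourgainNorm_eq, bourgainNorm_eq, ← ENNReal.coe_pow, NNReal.sq_sqrt]
        push_cast
        ring
  exact (ENNReal.pow_le_pow_left_iff two_ne_zero).1 hsq

theorem exists_bilinearL2Estimate {α β : ℝ} (hα : α < 2) (hβ : -2 < β) (hαβ : α - β ≤ 3 / 4) :
    ∃ ε₀ : ℝ, 0 < ε₀ ∧ ∀ ε : ℝ, 0 < ε → ε < ε₀ → BilinearL2Estimate ε (-α) β := by
  obtain ⟨α', h1, h2, h3, h4⟩ : ∃ α', -(5 / 4) < α' ∧ α' < 2 ∧ α ≤ α' ∧ α' - 3 / 4 ≤ β := by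
    -- Raising `α` to the endpoint `β + 3 / 4` may leave the range `α < 2`, so it is cut off at `0`.
    refine ⟨max α (min (β + 3 / 4) 0), ?_, ?_, le_max_left _ _, ?_⟩
    · exact lt_max_of_lt_right (lt_min (by linarith) (by norm_num))
    · exact max_lt hα ((min_le_right _ _).trans_lt (by norm_num))
    · have : max α (min (β + 3 / 4) 0) ≤ β + 3 / 4 := max_le (by linarith) (min_le_left _ _)
      linarith
  obtain ⟨ε₀, hε₀, h⟩ := exists_bilinearL2Estimate_endpoint h1 h2
  exact ⟨ε₀, hε₀, fun ε hε hlt => (h ε hε hlt).mono (by linarith) h4⟩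

end

theorem proposition4 :
    (∃ ε₀ : ℝ, 0 < ε₀ ∧ ∀ ε : ℝ, 0 < ε → ε < ε₀ →
      BilinearL2Estimate ε (-(3 / 2)) (3 / 4) ∧
      BilinearL2Estimate ε (-(3 / 4)) 0 ∧
      BilinearL2Estimate ε (-(1 / 4)) (-(1 / 2))) ∧
    (∀ α β : ℝ, α < 2 → -2 < β → α - β ≤ 3 / 4 →
      ∃ ε₀ : ℝ, 0 < ε₀ ∧ ∀ ε : ℝ, 0 < ε → ε < ε₀ → BilinearL2Estimate ε (-α) β) := by
  refine ⟨?_, fun α β hα hβ hαβ => exists_bilinearL2Estimate hα hβ hαβ⟩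
  obtain ⟨ε₁, h₁, H₁⟩ := exists_bilinearL2Estimate (α := 3 / 2) (β := 3 / 4) (by norm_num)
    (by norm_num) (by norm_num)
  obtain ⟨ε₂, h₂, H₂⟩ := exists_bilinearL2Estimate (α := 3 / 4) (β := 0) (by norm_num)
    (by norm_num) (by norm_num)
  obtain ⟨ε₃, h₃, H₃⟩ := exists_bilinearL2Estimate (α := 1 / 4) (β := -(1 / 2)) (by norm_num)
    (by norm_num) (by norm_num)
  refine ⟨min ε₁ (min ε₂ ε₃), lt_min h₁ (lt_min h₂ h₃), fun ε hε hlt => ?_⟩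
  rw [lt_min_iff, lt_min_iff] at hlt
  exact ⟨H₁ ε hε hlt.1, H₂ ε hε hlt.2.1, H₃ ε hε hlt.2.2⟩
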